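/- For $s\in\{0,1\}^n$ let $\mathcal C_s=\prod_{i=1}^n[s_i-2,\,s_i+1]\subset\mathbb R^n$ and let $f(x)=\sum_{i=1}^n x_i$. The membership oracle of $\mathcal C_s$ is the unitary $O_{\mathcal C_s}|x,b,w\rangle=|x,\,b\oplus\delta[x\in\mathcal C_s],\,w\rangle$, where $x\in\mathbb R^n$ is the query point, $b\in\{0,1\}$, $w$ ranges over the basis labels of an arbitrary workspace, and $\delta[P]$ is $1$ if $P$ holds and $0$ otherwise. A quantum algorithm making $T$ queries starts in a fixed unit vector of the Hilbert space with orthonormal basis $\{|x,b,w\rangle\}$, applies $U_T\,O_{\mathcal C_s}\,U_{T-1}\,O_{\mathcal C_s}\cdots O_{\mathcal C_s}\,U_0$ with arbitrary unitaries $U_0,\dots,U_T$ that do not depend on $s$, measures in this basis, and outputs a point $\tilde x\in\mathbb R^n$ that is a fixed function of the measurement outcome. There is a constant $c>0$ such that, for every $n$, every quantum algorithm which, for every $s\in\{0,1\}^n$ (unknown to the algorithm), given the membership oracle $O_{\mathcal C_s}$, outputs with probability at least $0.9$ a point $\tilde x\in\mathcal C_s$ with $$f(\tilde x)\le\min_{x\in\mathcal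 C_s}f(x)+\tfrac13$$ makes at least $c\sqrt n$ queries to $O_{\mathcal C_s}$. That is, $\Omega(\sqrt n)$ quantum membership queries are necessary. -/

import Mathlib

noncomputable section

/-! ### The sum-of-coordinates problem -/

/-- The hypercube `×ᵢ [sᵢ - 2, sᵢ + 1]` with offset string `s ∈ {0,1}ⁿ`
(`Bool.toNat` sends `false`, `true` to `0`, `1`). -/
def offsetCube {n : ℕ} (s : Fin n → Bool) : Set (Fin n → ℝ) :=
  Set.univ.pi fun i => Set.Icc (((s i).toNat : ℝ) - 2) (((s i).toNat : ℝ) + 1)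

/-- The objective function `x ↦ ∑ᵢ xᵢ`. -/
def coordSum {n : ℕ} (x : Fin n → ℝ) : ℝ := ∑ i, x i

/-- `x` is a point of `K` with `f x ≤ min_K f + ε`; the minimum is required to be attained. -/
def IsApproxMinimizer {n : ℕ} (K : Set (Fin n → ℝ)) (f : (Fin n → ℝ) → ℝ) (ε : ℝ)
    (x : Fin n → ℝ) : Prop :=
  x ∈ K ∧ ∃ m : ℝ, IsLeast (f '' K) m ∧ f x ≤ m + ε

/-! ### Quantum query algorithms with a membership oracle -/

/-- Labels `(x, b, w)` of the computational basis: a query point `x ∈ ℝⁿ`, an answer bit `b`, and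
the content `w` of a workspace with basis labelled by `W`. -/
abbrev BasisLabel (n : ℕ) (W : Type*) : Type _ := (Fin n → ℝ) × Bool × W

/-- The Hilbert space with orthonormal basis `|x, b, w⟩`. -/
abbrev QState (n : ℕ) (W : Type*) : Type _ := lp (fun _ : BasisLabel n W => ℂ) 2

/-- The basis vector `|x, b, w⟩`. -/
def ket {n : ℕ} {W : Type*} (z : BasisLabel n W) : QState n W :=
  open Classical in lp.single 2 z (1 : ℂ)

/-- The action `(x, b, w) ↦ (x, b ⊕ δ[x ∈ K], w)` of the membership oracle on basis labels. -/
def oracleLabel {n : ℕ} {W : Type*} (K : Set (Fin n → ℝ)) (z : BasisLabel n W) : BasisLabel n W :=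
  open Classical in (z.1, xor z.2.1 (decide (z.1 ∈ K)), z.2.2)

theorem oracleLabel_involutive {n : ℕ} {W : Type*} (K : Set (Fin n → ℝ)) :
    Function.Involutive (oracleLabel (W := W) K) := by
  rintro ⟨x, b, w⟩
  by_cases h : x ∈ K <;> simp [oracleLabel, h]

theorem memℓp_comp_perm {ι : Type*} (σ : Equiv.Perm ι) (ψ : lp (fun _ : ι => ℂ) 2) :
    Memℓp (E := fun _ : ι => ℂ) (fun i => ψ (σ i)) 2 := by
  have h := lp.memℓp ψ
  rw [memℓp_gen_iff (by norm_num)] at h ⊢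
  exact (σ.summable_iff (f := fun i => ‖ψ i‖ ^ (2 : ENNReal).toReal)).2 h

/-- The unitary on `ℓ²(ι)` given by `(U ψ) i = ψ (σ⁻¹ i)`, that is, `U |i⟩ = |σ i⟩`. -/
def permUnitary {ι : Type*} (σ : Equiv.Perm ι) :
    lp (fun _ : ι => ℂ) 2 ≃ₗᵢ[ℂ] lp (fun _ : ι => ℂ) 2 where
  toFun ψ := ⟨fun i => ψ (σ.symm i), memℓp_comp_perm σ.symm ψ⟩
  invFun ψ := ⟨fun i => ψ (σ i), memℓp_comp_perm σ ψ⟩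
  map_add' _ _ := rfl
  map_smul' _ _ := rfl
  left_inv ψ := by ext i; simp
  right_inv ψ := by ext i; simp
  norm_map' ψ := by
    rw [lp.norm_eq_tsum_rpow (by norm_num), lp.norm_eq_tsum_rpow (by norm_num)]
    congr 1
    exact σ.symm.tsum_eq (fun i => ‖ψ i‖ ^ (2 : ENNReal).toReal)

/-- The membership oracle `O_K`, the unitary with `O_K |x, b, w⟩ = |x, b ⊕ δ[x ∈ K], w⟩`. -/
def membershipOracle {n : ℕ} (W : Type*) (K : Set (Fin n → ℝ)) : QState n W ≃ₗᵢ[ℂ] QState n W :=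
  permUnitary (oracleLabel_involutive K).toPerm

theorem membershipOracle_ket {n : ℕ} {W : Type*} (K : Set (Fin n → ℝ)) (z : BasisLabel n W) :
    membershipOracle W K (ket z) = ket (oracleLabel K z) := by
  classical
  ext i
  change ket z (oracleLabel K i) = ket (oracleLabel K z) i
  simp only [ket, lp.single_apply, Pi.single_apply, (oracleLabel_involutive K).eq_iff]

/-- A quantum algorithm making `queries` queries: an initial state, arbitrary unitaries applied
before, between and after the queries, and a final measurement in the computational basis whose
outcome is turned into a point of `ℝⁿ`. None of this data depends on the oracle. Only
`unitary 0, …, unitary queries` are used. -/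
structure QueryAlgorithm (n : ℕ) (W : Type*) where
  queries : ℕ
  init : QState n W
  norm_init : ‖init‖ = 1
  unitary : ℕ → (QState n W ≃ₗᵢ[ℂ] QState n W)
  output : BasisLabel n W → (Fin n → ℝ)

namespace QueryAlgorithm

/-- The state `U_t O_K U_{t-1} ⋯ O_K U_0 |init⟩` reached after `t` queries. -/
def stateAfter {n : ℕ} {W : Type*} (A : QueryAlgorithm n W) (K : Set (Fin n → ℝ)) : ℕ → QState n W
  | 0 => A.unitary 0 A.init
  | t + 1 => A.unitary (t + 1) (membershipOracle W K (A.stateAfter K t))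

/-- The probability that the point output by `A`, run with membership oracle `O_K`, satisfies
`good` (a sum of the squared absolute values of the amplitudes of a unit vector). -/
def probOutput {n : ℕ} {W : Type*} (A : QueryAlgorithm n W) (K : Set (Fin n → ℝ))
    (good : (Fin n → ℝ) → Prop) : ℝ :=
  ∑' z : {z : BasisLabel n W // good (A.output z)}, ‖A.stateAfter K A.queries z.1‖ ^ 2

/-- For every offset string `s`, given the membership oracle of the hypercube of `s`, the algorithm
outputs an `ε`-approximate minimizer of the sum of the coordinates over that hypercube with
probability at least `p`. -/
def SolvesSumOfCoordinates {n : ℕ} {W : Type*} (A : QueryAlgorithm n W) (ε p : ℝ) : Prop :=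
  ∀ s : Fin n → Bool,
    p ≤ A.probOutput (offsetCube s) (IsApproxMinimizer (offsetCube s) coordSum ε)

end QueryAlgorithm

end

open scoped InnerProductSpace

/-! ### Mass of an `ℓ²` vector on a set of labels -/

/-! This is an adversary argument over pairs of strings differing in one bit. The sum of overlaps of
their states starts at `n * 2 ^ n`. Approximate minimizers determine `s` (`offset_unique`), so
success forces every overlap down to `3 / 5`. A query lowers the sum by at most `4 * 2 ^ n * √n`:
only query points separating the two cubes matter, and a point outside the cube of `s` lies in at
most one neighbouring cube. A point inside may be missed by all `n` neighbours, and weighting the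
two kinds of mass by `1 / √n` and `√n` balances them. -/

/-- The squared norm of the restriction of `ψ` to the labels in `S`. -/
noncomputable def mass {ι : Type*} (ψ : lp (fun _ : ι => ℂ) 2) (S : Set ι) : ℝ :=
  ∑' i, S.indicator (fun i => ‖ψ i‖ ^ 2) i

section Mass

variable {ι : Type*} (ψ φ χ : lp (fun _ : ι => ℂ) 2) (S T : Set ι)

theorem summable_normSq : Summable fun i => ‖ψ i‖ ^ 2 := by
  have h := lp.memℓp ψ
  rw [memℓp_gen_iff (by norm_num)] at h
  simpa using h

theorem summable_indicator_normSq : Summable (S.indicator fun i => ‖ψ i‖ ^ 2) :=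
  (summable_normSq ψ).indicator S

theorem mass_univ : mass ψ Set.univ = ‖ψ‖ ^ 2 := by
  have h := lp.norm_rpow_eq_tsum (p := 2) (by norm_num) ψ
  simpa [mass] using h.symm

theorem mass_mono {S T : Set ι} (h : S ⊆ T) : mass ψ S ≤ mass ψ T :=
  (summable_indicator_normSq ψ S).tsum_le_tsum
    (fun i => Set.indicator_le_indicator_of_subset h (fun _ => by positivity) i)
    (summable_indicator_normSq ψ T)

theorem mass_le_normSq : mass ψ S ≤ ‖ψ‖ ^ 2 :=
  mass_univ ψ ▸ mass_mono ψ (Set.subset_univ S)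

theorem mass_add_mass_compl : mass ψ S + mass ψ Sᶜ = ‖ψ‖ ^ 2 := by
  rw [← mass_univ, mass, mass, mass, ← (summable_indicator_normSq ψ S).tsum_add
    (summable_indicator_normSq ψ Sᶜ)]
  congr 1 with i
  by_cases h : i ∈ S <;> simp [h]

theorem mass_sub_le : mass (φ - χ) S ≤ 2 * mass φ S + 2 * mass χ S := by
  have h₁ := (summable_indicator_normSq φ S).mul_left 2
  have h₂ := (summable_indicator_normSq χ S).mul_left 2
  rw [mass, mass, mass, ← tsum_mul_left, ← tsum_mul_left, ← h₁.tsum_add h₂]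
  refine (summable_indicator_normSq (φ - χ) S).tsum_le_tsum (fun i => ?_) (h₁.add h₂)
  by_cases h : i ∈ S
  · have h₃ : ‖φ i - χ i‖ ≤ ‖φ i‖ + ‖χ i‖ := norm_sub_le _ _
    simp only [h, Set.indicator_of_mem, lp.coeFn_sub, Pi.sub_apply]
    nlinarith [norm_nonneg (φ i - χ i), sq_nonneg (‖φ i‖ - ‖χ i‖)]
  · simp [h]

/-- The masses on pairwise disjoint sets add up to at most the squared norm. -/
theorem sum_mass_le_normSq {κ : Type*} (s : Finset κ) (S : κ → Set ι)
    (hS : ∀ i, ∀ j ∈ s, ∀ k ∈ s, i ∈ S j → i ∈ S k → j = k) :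
    ∑ j ∈ s, mass ψ (S j) ≤ ‖ψ‖ ^ 2 := by
  simp only [mass]
  rw [← mass_univ, mass, ← Summable.tsum_finsetSum fun j _ => summable_indicator_normSq ψ (S j)]
  refine (summable_sum fun j _ => summable_indicator_normSq ψ (S j)).tsum_le_tsum (fun i => ?_)
    (summable_indicator_normSq ψ Set.univ)
  rw [Set.indicator_univ]
  by_cases h : ∃ j ∈ s, i ∈ S j
  · obtain ⟨j, hj, hij⟩ := h
    rw [Finset.sum_eq_single_of_mem j hj fun k hk hkj =>
      Set.indicator_of_notMem (fun hik => hkj (hS i k hk j hj hik hij)) _]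
    exact Set.indicator_le_self' (fun _ _ => by positivity) i
  · rw [Finset.sum_eq_zero fun j hj => Set.indicator_of_notMem (fun hij => h ⟨j, hj, hij⟩) _]
    positivity

/-- Weighted AM-GM for inner products, with different weights on the two parts of the support. -/
theorem re_inner_le_mass {a b : ℝ} (ha : 0 < a) (hb : 0 < b)
    (hφ : ∀ i, i ∉ S → i ∉ T → φ i = 0) :
    (⟪ψ, φ⟫_ℂ).re ≤
      (mass ψ S / a + a * mass φ S + mass ψ T / b + b * mass φ T) / 2 := by
  have h := (lp.hasSum_inner (𝕜 := ℂ) ψ φ).mapL Complex.reCLM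
  have hS := (((summable_indicator_normSq ψ S).hasSum.div_const a).add
    ((summable_indicator_normSq φ S).hasSum.mul_left a))
  have hT := (((summable_indicator_normSq ψ T).hasSum.div_const b).add
    ((summable_indicator_normSq φ T).hasSum.mul_left b))
  refine (hasSum_le (fun i => ?_) h ((hS.add hT).div_const 2)).trans_eq
    (by simp only [mass]; ring)
  have amgm : ∀ c : ℝ, 0 < c → ‖ψ i‖ * ‖φ i‖ ≤ (‖ψ i‖ ^ 2 / c + c * ‖φ i‖ ^ 2) / 2 := by
    intro c hc
    have : (‖ψ i‖ ^ 2 / c + c * ‖φ i‖ ^ 2) / 2 - ‖ψ i‖ * ‖φ i‖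
        = (‖ψ i‖ - c * ‖φ i‖) ^ 2 / (2 * c) := by field_simp; ring
    have : 0 ≤ (‖ψ i‖ - c * ‖φ i‖) ^ 2 / (2 * c) := by positivity
    linarith
  have hre : Complex.reCLM ⟪ψ i, φ i⟫_ℂ ≤ ‖ψ i‖ * ‖φ i‖ :=
    (Complex.re_le_norm _).trans (norm_inner_le_norm _ _)
  have pos : ∀ c : ℝ, 0 < c → 0 ≤ ‖ψ i‖ ^ 2 / c + c * ‖φ i‖ ^ 2 := fun c hc => by positivity
  by_cases h₁ : i ∈ S <;> by_cases h₂ : i ∈ T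
  · simp only [h₁, h₂, Set.indicator_of_mem]
    linarith [amgm a ha, pos b hb]
  · simp only [h₁, h₂, Set.indicator_of_mem, Set.indicator_of_notMem, not_false_eq_true, zero_div,
      mul_zero, add_zero]
    linarith [amgm a ha]
  · simp only [h₁, h₂, Set.indicator_of_mem, Set.indicator_of_notMem, not_false_eq_true, zero_div,
      mul_zero, add_zero, zero_add]
    linarith [amgm b hb]
  · simp [h₁, h₂, hφ i h₁ h₂]

/-- Two unit vectors mostly supported on disjoint sets have small overlap. -/
theorem re_inner_le_of_mass {ψ φ : lp (fun _ : ι => ℂ) 2} {S T : Set ι} (hST : Disjoint S T)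
    (hψ : ‖ψ‖ = 1) (hφ : ‖φ‖ = 1) (hS : 0.9 ≤ mass ψ S) (hT : 0.9 ≤ mass φ T) :
    (⟪ψ, φ⟫_ℂ).re ≤ 3 / 5 := by
  -- The weight `3 = √(0.9 / 0.1)` is optimal and yields `2 * √(0.9 * 0.1) = 3 / 5`.
  have h := re_inner_le_mass ψ φ S Sᶜ (a := 3) (b := 1 / 3) (by norm_num) (by norm_num)
    (fun i h₁ h₂ => absurd h₁ h₂)
  have h₁ := mass_add_mass_compl ψ S
  have h₂ := mass_add_mass_compl φ S
  have h₃ := mass_mono φ (show T ⊆ Sᶜ from hST.subset_compl_left)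
  rw [hψ] at h₁
  rw [hφ] at h₂
  norm_num at hS hT h h₁ h₂
  linarith

end Mass

/-! ### The effect of one query -/

section Oracle

variable {n : ℕ} {W : Type*} (K L : Set (Fin n → ℝ)) (ψ φ : QState n W)

/-- The mass of a state on the labels whose query point lies in `X`. -/
noncomputable def queryMass (X : Set (Fin n → ℝ)) : ℝ := mass ψ {z | z.1 ∈ X}

theorem membershipOracle_apply (z : BasisLabel n W) :
    membershipOracle W K ψ z = ψ (oracleLabel K z) := rfl

theorem membershipOracle_membershipOracle :
    membershipOracle W K (membershipOracle W K ψ) = ψ := by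
  ext z
  rw [membershipOracle_apply, membershipOracle_apply, oracleLabel_involutive]

theorem queryMass_membershipOracle (X : Set (Fin n → ℝ)) :
    queryMass (membershipOracle W K ψ) X = queryMass ψ X :=
  (oracleLabel_involutive (W := W) K).toPerm.tsum_eq
    ({z : BasisLabel n W | z.1 ∈ X}.indicator fun z => ‖ψ z‖ ^ 2)

theorem oracleLabel_congr {K L : Set (Fin n → ℝ)} {z : BasisLabel n W}
    (h : z.1 ∈ K ↔ z.1 ∈ L) : oracleLabel K z = oracleLabel L z := by
  simp [oracleLabel, h]

/-- One query decreases the overlap of two states by little, if the states carry little mass on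
query points that distinguish the oracles. -/
theorem re_inner_sub_re_inner_membershipOracle_le {r : ℝ} (hr : 0 < r) :
    (⟪ψ, φ⟫_ℂ).re - (⟪membershipOracle W K ψ, membershipOracle W L φ⟫_ℂ).re ≤
      (queryMass ψ (K \ L) / r + r * queryMass ψ (L \ K)) +
      (queryMass φ (L \ K) / r + r * queryMass φ (K \ L)) := by
  -- Moving the self-inverse `O_K` across turns the loss into `⟪ψ, φ - χ⟫`, and `χ` agrees with `φ`
  -- wherever `K` and `L` agree.
  set χ := membershipOracle W K (membershipOracle W L φ) with hχ
  have h : ⟪membershipOracle W K ψ, membershipOracle W L φ⟫_ℂ = ⟪ψ, χ⟫_ℂ := by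
    rw [hχ, ← (membershipOracle W K).inner_map_map, membershipOracle_membershipOracle]
  have hmass (X) : queryMass (φ - χ) X ≤ 4 * queryMass φ X := by
    have := mass_sub_le φ χ {z | z.1 ∈ X}
    have h₁ : queryMass χ X = queryMass φ X := by
      rw [hχ, queryMass_membershipOracle, queryMass_membershipOracle]
    simp only [queryMass] at *
    linarith
  have hsupp : ∀ z : BasisLabel n W, z ∉ {z : BasisLabel n W | z.1 ∈ K \ L} →
      z ∉ {z : BasisLabel n W | z.1 ∈ L \ K} → (φ - χ) z = 0 := by
    intro z h₁ h₂
    have hz : z.1 ∈ K ↔ z.1 ∈ L := by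
      simp only [Set.mem_ofPred_eq, Set.mem_sdiff] at h₁ h₂; tauto
    have : χ z = φ z := by
      rw [hχ, membershipOracle_apply, membershipOracle_apply, oracleLabel_congr hz,
        oracleLabel_involutive]
    simp [this]
  -- These weights absorb the factor 4 of `hmass`, so that `ψ` and `φ` enter symmetrically with `K`
  -- and `L` exchanged.
  have key := re_inner_le_mass ψ (φ - χ) _ _ (a := r / 2) (b := 1 / (2 * r)) (by positivity)
    (by positivity) hsupp
  have h₁ := mul_le_mul_of_nonneg_left (hmass (K \ L)) (show 0 ≤ r / 4 by positivity)
  have h₂ := mul_le_mul_of_nonneg_left (hmass (L \ K)) (show 0 ≤ 1 / (4 * r) by positivity)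
  rw [h, ← Complex.sub_re, ← inner_sub_right]
  refine key.trans ?_
  simp only [← queryMass.eq_def]
  have e : (queryMass ψ (K \ L) / (r / 2) + r / 2 * queryMass (φ - χ) (K \ L)
      + queryMass ψ (L \ K) / (1 / (2 * r)) + 1 / (2 * r) * queryMass (φ - χ) (L \ K)) / 2
      = queryMass ψ (K \ L) / r + r * queryMass ψ (L \ K)
        + (r / 4 * queryMass (φ - χ) (K \ L) + 1 / (4 * r) * queryMass (φ - χ) (L \ K)) := by
    field_simp; ring
  have e' : 1 / (4 * r) * (4 * queryMass φ (L \ K)) = queryMass φ (L \ K) / r := by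
    field_simp
  rw [e'] at h₂
  rw [e]
  linarith

end Oracle

/-! ### Offset cubes of neighbouring strings -/

section Cube

variable {n : ℕ}

/-- Flip the `i`-th bit of `s`. -/
def flipBit (i : Fin n) (s : Fin n → Bool) : Fin n → Bool := Function.update s i (!s i)

theorem flipBit_involutive (i : Fin n) : Function.Involutive (flipBit i) := by
  intro s; simp [flipBit]

theorem flipBit_ne (i : Fin n) (s : Fin n → Bool) : flipBit i s ≠ s := fun h => by
  simpa [flipBit] using congrFun h i

/-- A point outside the cube of `s` lies in the cube of at most one neighbour of `s`. -/
theorem eq_of_mem_offsetCube_flipBit {s : Fin n → Bool} {x : Fin n → ℝ} {i j : Fin n}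
    (hs : x ∉ offsetCube s) (hi : x ∈ offsetCube (flipBit i s))
    (hj : x ∈ offsetCube (flipBit j s)) : i = j := by
  by_contra hij
  refine hs fun k _ => ?_
  -- At each coordinate, at least one of the two flips leaves the constraint of `s` unchanged.
  by_cases hk : k = i
  · have hkj : k ≠ j := fun h => hij (hk.symm.trans h)
    simpa only [flipBit, Function.update_of_ne hkj] using hj k trivial
  · simpa only [flipBit, Function.update_of_ne hk] using hi k trivial

/-- The excess over the lower corner is a sum of nonnegative terms, so it bounds each of them. -/
theorem coordSum_ge_of_mem {s : Fin n → Bool} {x : Fin n → ℝ} (hx : x ∈ offsetCube s) (i : Fin n) :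
    coordSum (fun j => ((s j).toNat : ℝ) - 2) + (x i - ((s i).toNat - 2)) ≤ coordSum x := by
  have h : ∀ j, 0 ≤ x j - ((s j).toNat - 2 : ℝ) := fun j => sub_nonneg.2 (hx j trivial).1
  have := Finset.single_le_sum (fun j _ => h j) (Finset.mem_univ i)
  rw [Finset.sum_sub_distrib] at this
  simp only [coordSum]
  linarith

/-- Every coordinate of an approximate minimizer is close to the lower corner. -/
theorem IsApproxMinimizer.le_apply {s : Fin n → Bool} {x : Fin n → ℝ} {ε : ℝ}
    (hx : IsApproxMinimizer (offsetCube s) coordSum ε x) (i : Fin n) :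
    ((s i).toNat : ℝ) - 2 ≤ x i ∧ x i ≤ (s i).toNat - 2 + ε := by
  obtain ⟨hK, m, hm, hle⟩ := hx
  have hcorner : (fun j => ((s j).toNat : ℝ) - 2) ∈ offsetCube s := fun j _ =>
    ⟨le_rfl, by linarith⟩
  have h₁ := hm.2 ⟨_, hcorner, rfl⟩
  have h₂ := coordSum_ge_of_mem hK i
  exact ⟨(hK i trivial).1, by linarith⟩

/-- The windows `[-2, -5/3]` and `[-1, -2/3]` for the two bit values are disjoint. -/
theorem IsApproxMinimizer.offset_unique {s t : Fin n → Bool} {x : Fin n → ℝ}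
    (hs : IsApproxMinimizer (offsetCube s) coordSum (1 / 3) x)
    (ht : IsApproxMinimizer (offsetCube t) coordSum (1 / 3) x) : s = t := by
  ext1 i
  have h₁ := hs.le_apply i
  have h₂ := ht.le_apply i
  cases hsi : s i <;> cases hti : t i <;> simp [hsi, hti] at h₁ h₂ ⊢ <;> linarith

/-- The first bound is termwise; the second uses that the sets are disjoint. -/
theorem sum_queryMass_flipBit_le {W : Type*} (ψ : QState n W) (hψ : ‖ψ‖ = 1)
    (s : Fin n → Bool) :
    ∑ i, queryMass ψ (offsetCube s \ offsetCube (flipBit i s)) ≤ n ∧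
      ∑ i, queryMass ψ (offsetCube (flipBit i s) \ offsetCube s) ≤ 1 := by
  have hψ' : ‖ψ‖ ^ 2 = 1 := by rw [hψ, one_pow]
  constructor
  · refine (Finset.sum_le_card_nsmul _ _ 1 fun i _ => ?_).trans (by simp)
    exact hψ' ▸ mass_le_normSq ψ _
  · rw [← hψ']
    exact sum_mass_le_normSq ψ Finset.univ _ fun z i _ j _ hi hj =>
      eq_of_mem_offsetCube_flipBit hi.2 hi.1 hj.1

end Cube

/-! ### The adversary argument -/

namespace QueryAlgorithm

variable {n : ℕ} {W : Type*} (A : QueryAlgorithm n W)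

theorem norm_stateAfter (K : Set (Fin n → ℝ)) (t : ℕ) : ‖A.stateAfter K t‖ = 1 := by
  induction t with
  | zero => rw [stateAfter, LinearIsometryEquiv.norm_map, A.norm_init]
  | succ t ih => rw [stateAfter, LinearIsometryEquiv.norm_map, LinearIsometryEquiv.norm_map, ih]

/-- The total overlap, after `t` queries, of the states of neighbouring offset strings. -/
noncomputable def overlap (t : ℕ) : ℝ :=
  ∑ i, ∑ s : Fin n → Bool,
    (⟪A.stateAfter (offsetCube s) t, A.stateAfter (offsetCube (flipBit i s)) t⟫_ℂ).re

theorem overlap_zero : A.overlap 0 = n * 2 ^ n := by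
  have h (K : Set (Fin n → ℝ)) : A.stateAfter K 0 = A.unitary 0 A.init := rfl
  simp [overlap, h, A.norm_init, inner_self_eq_norm_sq_to_K]

theorem overlap_sub_overlap_succ_le (hn : 0 < n) (t : ℕ) :
    A.overlap t - A.overlap (t + 1) ≤ 4 * 2 ^ n * √n := by
  set ψ : (Fin n → Bool) → QState n W := fun s => A.stateAfter (offsetCube s) t with hψ
  set r : ℝ := √n
  have hr : 0 < r := Real.sqrt_pos.2 (by exact_mod_cast hn)
  have hrr : (n : ℝ) / r = r := Real.div_sqrt
  -- The loss on an edge splits into a charge at each endpoint; summed over `i`, the charge at `s`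
  -- is at most `n / r + r = 2 * r`.
  let g (i : Fin n) (s : Fin n → Bool) : ℝ :=
    queryMass (ψ s) (offsetCube s \ offsetCube (flipBit i s)) / r +
      r * queryMass (ψ s) (offsetCube (flipBit i s) \ offsetCube s)
  have hstep (i : Fin n) (s : Fin n → Bool) :
      (⟪A.stateAfter (offsetCube s) t, A.stateAfter (offsetCube (flipBit i s)) t⟫_ℂ).re -
      (⟪A.stateAfter (offsetCube s) (t + 1),
        A.stateAfter (offsetCube (flipBit i s)) (t + 1)⟫_ℂ).re ≤ g i s + g i (flipBit i s) := by
    rw [stateAfter, stateAfter, LinearIsometryEquiv.inner_map_map]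
    refine (re_inner_sub_re_inner_membershipOracle_le _ _ _ _ hr).trans_eq ?_
    simp only [g, hψ, flipBit_involutive i s]
  have hflip (i : Fin n) : ∑ s, g i (flipBit i s) = ∑ s, g i s :=
    (flipBit_involutive i).toPerm.sum_comp _ (g i) (by simp)
  have hg (s : Fin n → Bool) : ∑ i, g i s ≤ 2 * r := by
    obtain ⟨h₁, h₂⟩ := sum_queryMass_flipBit_le (ψ s) (A.norm_stateAfter _ t) s
    simp only [g, Finset.sum_add_distrib, ← Finset.sum_div, ← Finset.mul_sum]
    have h₃ := div_le_div_of_nonneg_right h₁ hr.le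
    have h₄ := mul_le_mul_of_nonneg_left h₂ hr.le
    linarith
  have hgg : ∑ s, ∑ i, g i s ≤ 2 ^ n * (2 * r) :=
    (Finset.sum_le_card_nsmul _ _ _ fun s _ => hg s).trans_eq (by simp)
  calc A.overlap t - A.overlap (t + 1)
      ≤ ∑ i, ∑ s, (g i s + g i (flipBit i s)) := by
        simp only [overlap, ← Finset.sum_sub_distrib]
        exact Finset.sum_le_sum fun i _ => Finset.sum_le_sum fun s _ => hstep i s
    _ = 2 * ∑ s, ∑ i, g i s := by
        simp only [Finset.sum_add_distrib, hflip]
        rw [Finset.sum_comm]; ring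
    _ ≤ 4 * 2 ^ n * r := by linarith

theorem overlap_zero_sub_overlap_le (hn : 0 < n) (t : ℕ) :
    A.overlap 0 - A.overlap t ≤ t * (4 * 2 ^ n * √n) := by
  induction t with
  | zero => simp
  | succ t ih =>
    have := A.overlap_sub_overlap_succ_le hn t
    push_cast
    linarith

theorem probOutput_eq_mass (K : Set (Fin n → ℝ)) (good : (Fin n → ℝ) → Prop) :
    A.probOutput K good = mass (A.stateAfter K A.queries) {z | good (A.output z)} :=
  tsum_subtype {z | good (A.output z)} fun z => ‖A.stateAfter K A.queries z‖ ^ 2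

theorem overlap_queries_le (hA : A.SolvesSumOfCoordinates (1 / 3) 0.9) :
    A.overlap A.queries ≤ 3 / 5 * (n * 2 ^ n) := by
  have h (i : Fin n) (s : Fin n → Bool) : (⟪A.stateAfter (offsetCube s) A.queries,
      A.stateAfter (offsetCube (flipBit i s)) A.queries⟫_ℂ).re ≤ 3 / 5 := by
    refine re_inner_le_of_mass ?_ (A.norm_stateAfter _ _) (A.norm_stateAfter _ _)
      ((hA s).trans_eq (A.probOutput_eq_mass _ _))
      ((hA (flipBit i s)).trans_eq (A.probOutput_eq_mass _ _))
    exact Set.disjoint_left.2 fun z h₁ h₂ => flipBit_ne i s (h₂.offset_unique h₁)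
  refine (Finset.sum_le_sum fun i _ => Finset.sum_le_sum fun s _ => h i s).trans_eq ?_
  simp
  ring

end QueryAlgorithm

theorem mainTheorem3 :
    ∃ c : ℝ, 0 < c ∧ ∀ (n : ℕ) (W : Type*) (A : QueryAlgorithm n W),
      A.SolvesSumOfCoordinates (1 / 3) 0.9 → c * Real.sqrt (n : ℝ) ≤ (A.queries : ℝ) := by
  -- The overlap must drop by the fraction `2 / 5`, and `(2 / 5) / 4 = 1 / 10`.
  refine ⟨1 / 10, by norm_num, fun n W A hA => ?_⟩
  rcases n.eq_zero_or_pos with rfl | hn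
  · simp
  have h₀ := A.overlap_zero
  have h₁ := A.overlap_zero_sub_overlap_le hn A.queries
  have h₂ := A.overlap_queries_le hA
  have hr : 0 < √(n : ℝ) := Real.sqrt_pos.2 (by exact_mod_cast hn)
  have hrr : √(n : ℝ) * √n = n := Real.mul_self_sqrt n.cast_nonneg
  have hpos : 0 < 4 * 2 ^ n * √(n : ℝ) := by positivity
  refine le_of_mul_le_mul_right ?_ hpos
  have e : 1 / 10 * √(n : ℝ) * (4 * 2 ^ n * √n) = 2 / 5 * (n * 2 ^ n) := by
    linear_combination (2 / 5 * 2 ^ n) * hrr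
  linarith
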